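/- Consider finite Feynman graphs of $\phi^4$ theory: multigraphs (self-loops allowed) in which every vertex is incident to exactly four half-edges, and in which some half-edges are left open as external edges (legs). A graph is of vertex type if it has four legs and of propagator type if it has two. A graph is 1PI if it is connected and stays connected when any one internal edge is removed. A connected graph with $|E|$ internal edges and $|V|$ vertices has $L=|E|-|V|+1$ loops. The circuit partition polynomial is $J(g,N)=\sum N^{\#\text{circuits}}$, the sum running over all $3^{|V|}$ ways to split the four half-edges at each vertex into two pairs, where a circuit is a closed strand of the resulting decomposition. The $O(N)$ symmetry factor is $T(g,N)=J(g,N)/J(g,1)=3^{-|V|}J(g,N)$. Assume that tadpole graphs vanish. Then a graph is primitive if it is 1PI, has at least one loop, is of propagator or vertex type, has no self-loop, and if every proper subgraph with fewer than six external edges is a tree, where subgraphs whose contraction to a point creates a self-loop (a tadpole, which vanishes) are disregarded. A graph has coradical degree $n$ if it is obtained from a primitive graph by $n-1$ insertions of primitive graphs, where vertex-type graphs are inserted in place of vertices and propagator-type graphs into internal edges, possibly into each other. It is fish-free if none of these $n$ primitive graphs is the fish (the one-loop vertex-type graph with two vertices joined by a double edge). Let $g$ be a 1PI fish-free $L$-loop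 vertex-type graph of coradical degree $n$. Then $$\deg_N T(g,N)\le \tfrac23 L-\tfrac13 n .$$ In particular, without fish, all graphs of leading order in $N$ are primitive, in the following sense: every such $g$ satisfies $\deg_N T(g,N)\le \tfrac23L-\tfrac23$, and if $\deg_N T(g,N)=\tfrac23L-\tfrac23$, then $g$ is primitive. -/

import Mathlib

open Polynomial

/-- A (finite) Feynman graph of `φ⁴` theory, given by half-edges. Every half-edge `h` is attached to
the vertex `vert h`, every vertex carries exactly four half-edges, and `mate` is an involution: two
distinct half-edges exchanged by `mate` form an internal edge, a half-edge fixed by `mate` is an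
external edge (leg). Multiple edges and self-loops are allowed. -/
structure FeynmanGraph where
  V : Type
  H : Type
  [fintypeV : Fintype V]
  [fintypeH : Fintype H]
  vert : H → V
  mate : H → H
  mate_mate : ∀ h, mate (mate h) = h
  four_valent : ∀ v, Nat.card {h // vert h = v} = 4

namespace FeynmanGraph

attribute [instance] FeynmanGraph.fintypeV FeynmanGraph.fintypeH

/-- Isomorphism of Feynman graphs (legs may be permuted). -/
structure Iso (g g' : FeynmanGraph) where
  onV : g.V ≃ g'.V
  onH : g.H ≃ g'.H
  vert_comm : ∀ h, g'.vert (onH h) = onV (g.vert h)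
  mate_comm : ∀ h, g'.mate (onH h) = onH (g.mate h)

section Basic

variable (g : FeynmanGraph)

/-- The number of external edges. -/
noncomputable def valence : ℕ := Nat.card {h : g.H // g.mate h = h}

/-- Vertex-type graphs have four external edges. -/
def IsVertexType : Prop := g.valence = 4

/-- The number of internal edges. -/
noncomputable def numEdges : ℕ := Nat.card {h : g.H // g.mate h ≠ h} / 2

/-- The number of loops `|E| - |V| + 1` of a connected graph (`E` the internal edges). -/
noncomputable def loopNumber : ℤ := (g.numEdges : ℤ) - (Nat.card g.V : ℤ) + 1

/-- The set `W` of vertices is nonempty, and any two vertices of `W` are joined by a path of edges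
whose half-edges lie in `S`. -/
def ConnectedVia (W : Set g.V) (S : Set g.H) : Prop :=
  W.Nonempty ∧ ∀ u ∈ W, ∀ w ∈ W,
    Relation.ReflTransGen (fun a b => ∃ h ∈ S, g.vert h = a ∧ g.vert (g.mate h) = b) u w

/-- One-particle irreducible: connected, also after the removal of any one internal edge. -/
def IsOnePI : Prop :=
  g.ConnectedVia Set.univ {h | g.mate h ≠ h} ∧
  ∀ e, g.mate e ≠ e → g.ConnectedVia Set.univ ({h | g.mate h ≠ h} \ {e, g.mate e})

/-- Some internal edge starts and ends at the same vertex. -/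
def HasSelfLoop : Prop := ∃ h, g.mate h ≠ h ∧ g.vert (g.mate h) = g.vert h

/-- The fish: two vertices joined by a double edge, and four legs. -/
def IsFish : Prop :=
  g.IsVertexType ∧ ∃ a b : g.V, a ≠ b ∧ (∀ v, v = a ∨ v = b) ∧
    Nat.card {h // g.vert h = a ∧ g.vert (g.mate h) = b} = 2

end Basic

/-! ### Subgraphs and primitive graphs -/

/-- A subgraph: a nonempty set of vertices together with a set of internal edges of `g` between them
(given by their half-edges). All other half-edges at its vertices become legs of the subgraph. -/
structure Subgraph (g : FeynmanGraph) where
  verts : Set g.V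
  halfEdges : Set g.H
  nonempty : verts.Nonempty
  internal : ∀ h ∈ halfEdges, g.mate h ≠ h
  mate_mem : ∀ h ∈ halfEdges, g.mate h ∈ halfEdges
  vert_mem : ∀ h ∈ halfEdges, g.vert h ∈ verts

namespace Subgraph

variable {g : FeynmanGraph} (γ : g.Subgraph)

/-- The number of external edges of a subgraph. -/
noncomputable def valence : ℕ := Set.ncard {h | g.vert h ∈ γ.verts ∧ h ∉ γ.halfEdges}

/-- Connected, and with one edge less than vertices. -/
def IsTree : Prop :=
  g.ConnectedVia γ.verts γ.halfEdges ∧ γ.halfEdges.ncard / 2 + 1 = γ.verts.ncard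

/-- The subgraph is not all of `g`. -/
def IsProper : Prop := ¬ (γ.verts = Set.univ ∧ γ.halfEdges = {h | g.mate h ≠ h})

/-- Contracting the subgraph to a point produces a self-loop at this point: some internal edge of
`g` joins two vertices of the subgraph without belonging to the subgraph. -/
def CographHasSelfLoop : Prop :=
  ∃ h, g.mate h ≠ h ∧ h ∉ γ.halfEdges ∧ g.vert h ∈ γ.verts ∧ g.vert (g.mate h) ∈ γ.verts

end Subgraph

/-- Primitive graphs of `φ⁴` theory in four dimensions, when tadpole graphs vanish. These are the
1PI graphs with at least one loop which are superficially divergent (of propagator type or vertex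
type), which are not a tadpole, and which have no subdivergence: every proper subgraph of valence
less than six is a tree, or its cograph is a tadpole and thus vanishes. -/
def IsPrimitive (g : FeynmanGraph) : Prop :=
  g.IsOnePI ∧ 1 ≤ g.loopNumber ∧ (g.valence = 2 ∨ g.valence = 4) ∧ ¬ g.HasSelfLoop ∧
  ∀ γ : g.Subgraph, γ.IsProper → γ.valence < 6 → γ.IsTree ∨ γ.CographHasSelfLoop

/-! ### The circuit partition polynomial and the `O(N)` symmetry factor -/

/-- A decomposition of the graph: at every vertex, a partition of the four half-edges into two pairs.
All these pairs are recorded by one fixed point free involution of the half-edges. -/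
def Decomposition (g : FeynmanGraph) : Type :=
  {σ : g.H → g.H // (∀ h, σ (σ h) = h) ∧ (∀ h, σ h ≠ h) ∧ ∀ h, g.vert (σ h) = g.vert h}

noncomputable instance (g : FeynmanGraph) : Fintype g.Decomposition :=
  haveI : Finite g.Decomposition := Subtype.finite
  Fintype.ofFinite _

/-- Two half-edges belong to the same strand (circuit or path) of the decomposition. -/
def strand {g : FeynmanGraph} (σ : g.Decomposition) : Setoid g.H :=
  Relation.EqvGen.setoid fun a b => b = σ.1 a ∨ b = g.mate a

/-- The number of circuits: the strands that contain no leg. -/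
noncomputable def numCircuits {g : FeynmanGraph} (σ : g.Decomposition) : ℕ :=
  Nat.card {c : Quotient (strand σ) // ∀ h : g.H, Quotient.mk (strand σ) h = c → g.mate h ≠ h}

/-- The circuit partition polynomial `J(g, N)`, a polynomial in the variable `N`. -/
noncomputable def circuitPolynomial (g : FeynmanGraph) : ℚ[X] :=
  ∑ σ : g.Decomposition, X ^ numCircuits σ

/-- The `O(N)` symmetry factor `T(g, N) = J(g, N) / J(g, 1)`, a polynomial in `N`. -/
noncomputable def symmetryFactor (g : FeynmanGraph) : ℚ[X] :=
  C (g.circuitPolynomial.eval 1)⁻¹ * g.circuitPolynomial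

/-! ### Insertion into a vertex -/

section VertexInsertion

variable (g : FeynmanGraph) (v : g.V) (γ : FeynmanGraph)
  (φ : {h : g.H // g.vert h = v} ≃ {k : γ.H // γ.mate k = k})

open Classical in
/-- Where a half-edge of `g` goes when `v` is replaced by `γ`: a half-edge at `v` becomes the leg of
`γ` with which it is matched. -/
noncomputable def vertexGlue (h : g.H) : {h : g.H // g.vert h ≠ v} ⊕ γ.H :=
  if hv : g.vert h = v then Sum.inr (φ ⟨h, hv⟩).1 else Sum.inl ⟨h, hv⟩

open Classical in
/-- The involution of the graph in which `v` is replaced by `γ`. -/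
noncomputable def vertexMate :
    {h : g.H // g.vert h ≠ v} ⊕ γ.H → {h : g.H // g.vert h ≠ v} ⊕ γ.H
  | Sum.inl h => vertexGlue g v γ φ (g.mate h.1)
  | Sum.inr k =>
      if hk : γ.mate k = k then vertexGlue g v γ φ (g.mate (φ.symm ⟨k, hk⟩).1)
      else Sum.inr (γ.mate k)

theorem vertexMate_glue (h : g.H) :
    vertexMate g v γ φ (vertexGlue g v γ φ h) = vertexGlue g v γ φ (g.mate h) := by
  by_cases hv : g.vert h = v
  · have e : vertexGlue g v γ φ h = Sum.inr (φ ⟨h, hv⟩).1 := dif_pos hv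
    rw [e]
    have hk := (φ ⟨h, hv⟩).2
    simp [vertexMate, hk]
  · have e : vertexGlue g v γ φ h = Sum.inl ⟨h, hv⟩ := dif_neg hv
    rw [e]
    rfl

theorem vertexMate_vertexMate (x : {h : g.H // g.vert h ≠ v} ⊕ γ.H) :
    vertexMate g v γ φ (vertexMate g v γ φ x) = x := by
  rcases x with h | k
  · change vertexMate g v γ φ (vertexGlue g v γ φ (g.mate h.1)) = _
    rw [vertexMate_glue, g.mate_mate]
    exact dif_neg h.2
  · by_cases hk : γ.mate k = k
    · have e : vertexMate g v γ φ (Sum.inr k) =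
          vertexGlue g v γ φ (g.mate (φ.symm ⟨k, hk⟩).1) := dif_pos hk
      rw [e, vertexMate_glue, g.mate_mate]
      have hv := (φ.symm ⟨k, hk⟩).2
      unfold vertexGlue
      rw [dif_pos hv]
      simp
    · have e : vertexMate g v γ φ (Sum.inr k) = Sum.inr (γ.mate k) := dif_neg hk
      have hk' : ¬ γ.mate (γ.mate k) = γ.mate k := by
        rw [γ.mate_mate]; exact fun h => hk h.symm
      have e' : vertexMate g v γ φ (Sum.inr (γ.mate k)) = Sum.inr (γ.mate (γ.mate k)) :=
        dif_neg hk'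
      rw [e, e', γ.mate_mate]

/-- The attachment of half-edges to vertices in the graph in which `v` is replaced by `γ`. -/
def vertexVert : {h : g.H // g.vert h ≠ v} ⊕ γ.H → {u : g.V // u ≠ v} ⊕ γ.V :=
  Sum.map (fun h => ⟨g.vert h.1, h.2⟩) γ.vert

theorem vertexVert_four (x : {u : g.V // u ≠ v} ⊕ γ.V) :
    Nat.card {y // vertexVert g v γ y = x} = 4 := by
  rcases x with u | w
  · rw [← g.four_valent u.1]
    refine (Nat.card_congr (Equiv.ofBijective
      (fun h : {h : g.H // g.vert h = u.1} =>
        (⟨Sum.inl ⟨h.1, by rw [h.2]; exact u.2⟩, by simp [vertexVert, h.2]⟩ :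
          {y // vertexVert g v γ y = Sum.inl u})) ⟨?_, ?_⟩)).symm
    · intro a b hab
      simpa [Subtype.ext_iff] using hab
    · rintro ⟨y | y, hy⟩
      · refine ⟨⟨y.1, ?_⟩, rfl⟩
        simpa [vertexVert, Subtype.ext_iff] using hy
      · simp [vertexVert] at hy
  · rw [← γ.four_valent w]
    refine (Nat.card_congr (Equiv.ofBijective
      (fun h : {h : γ.H // γ.vert h = w} =>
        (⟨Sum.inr h.1, by simp [vertexVert, h.2]⟩ :
          {y // vertexVert g v γ y = Sum.inr w})) ⟨?_, ?_⟩)).symm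
    · intro a b hab
      simpa [Subtype.ext_iff] using hab
    · rintro ⟨y | y, hy⟩
      · simp [vertexVert] at hy
      · refine ⟨⟨y, ?_⟩, rfl⟩
        simpa [vertexVert] using hy

open Classical in
/-- Insertion of the vertex-type graph `γ` in place of the vertex `v` of `g`, where the bijection `φ`
matches the four half-edges at `v` with the four legs of `γ`. -/
noncomputable def insertVertex : FeynmanGraph where
  V := {u : g.V // u ≠ v} ⊕ γ.V
  H := {h : g.H // g.vert h ≠ v} ⊕ γ.H
  vert := vertexVert g v γ
  mate := vertexMate g v γ φ
  mate_mate := vertexMate_vertexMate g v γ φ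
  four_valent := vertexVert_four g v γ

end VertexInsertion

/-! ### Insertion into an edge -/

section EdgeInsertion

variable (g : FeynmanGraph) (e : g.H) (γ : FeynmanGraph) (a b : γ.H)

open Classical in
/-- The involution of the graph in which `γ` is inserted into the edge `{e, mate e}`: the half-edge
`e` is joined to the leg `a` of `γ`, and `mate e` to the leg `b`. -/
noncomputable def edgeMate : g.H ⊕ γ.H → g.H ⊕ γ.H
  | Sum.inl h =>
      if h = e then Sum.inr a else if h = g.mate e then Sum.inr b else Sum.inl (g.mate h)
  | Sum.inr k =>
      if k = a then Sum.inl e else if k = b then Sum.inl (g.mate e) else Sum.inr (γ.mate k)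

theorem edgeMate_edgeMate (he : g.mate e ≠ e) (ha : γ.mate a = a) (hb : γ.mate b = b)
    (hab : a ≠ b) (x : g.H ⊕ γ.H) : edgeMate g e γ a b (edgeMate g e γ a b x) = x := by
  rcases x with h | k
  · by_cases h1 : h = e
    · simp [edgeMate, h1]
    · by_cases h2 : h = g.mate e
      · simp [edgeMate, h2, he, hab.symm]
      · have h3 : g.mate h ≠ e := fun h3 => h2 (by rw [← h3, g.mate_mate])
        have h4 : g.mate h ≠ g.mate e := fun h4 =>
          h1 (by rw [← g.mate_mate h, h4, g.mate_mate])
        simp [edgeMate, h1, h2, h3, h4, g.mate_mate]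
  · by_cases h1 : k = a
    · simp [edgeMate, h1]
    · by_cases h2 : k = b
      · simp [edgeMate, h2, he, hab.symm]
      · have h3 : γ.mate k ≠ a := fun h3 => h1 (by rw [← γ.mate_mate k, h3, ha])
        have h4 : γ.mate k ≠ b := fun h4 => h2 (by rw [← γ.mate_mate k, h4, hb])
        simp [edgeMate, h1, h2, h3, h4, γ.mate_mate]

theorem sumVert_four (x : g.V ⊕ γ.V) : Nat.card {y // Sum.map g.vert γ.vert y = x} = 4 := by
  rcases x with u | w
  · rw [← g.four_valent u]
    refine (Nat.card_congr (Equiv.ofBijective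
      (fun h : {h : g.H // g.vert h = u} =>
        (⟨Sum.inl h.1, by simp [h.2]⟩ :
          {y // Sum.map g.vert γ.vert y = Sum.inl u})) ⟨?_, ?_⟩)).symm
    · intro a b hab
      simpa [Subtype.ext_iff] using hab
    · rintro ⟨y | y, hy⟩
      · exact ⟨⟨y, by simpa using hy⟩, rfl⟩
      · simp at hy
  · rw [← γ.four_valent w]
    refine (Nat.card_congr (Equiv.ofBijective
      (fun h : {h : γ.H // γ.vert h = w} =>
        (⟨Sum.inr h.1, by simp [h.2]⟩ :
          {y // Sum.map g.vert γ.vert y = Sum.inr w})) ⟨?_, ?_⟩)).symm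
    · intro a b hab
      simpa [Subtype.ext_iff] using hab
    · rintro ⟨y | y, hy⟩
      · simp at hy
      · exact ⟨⟨y, by simpa using hy⟩, rfl⟩

/-- Insertion of a graph `γ` with the legs `a ≠ b` into the internal edge `{e, mate e}` of `g`. -/
noncomputable def insertEdge (he : g.mate e ≠ e) (ha : γ.mate a = a) (hb : γ.mate b = b)
    (hab : a ≠ b) : FeynmanGraph where
  V := g.V ⊕ γ.V
  H := g.H ⊕ γ.H
  vert := Sum.map g.vert γ.vert
  mate := edgeMate g e γ a b
  mate_mate := edgeMate_edgeMate g e γ a b he ha hb hab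
  four_valent := sumVert_four g γ

end EdgeInsertion

/-! ### Coradical degree -/

/-- `BuiltFrom P g n`: up to isomorphism, the graph `g` arises by inserting graphs into each other,
in place of vertices (vertex-type graphs) or into internal edges (propagator-type graphs), where
the building blocks are `n` graphs (counted with repetition) that all satisfy `P`. -/
inductive BuiltFrom (P : FeynmanGraph → Prop) : FeynmanGraph → ℕ → Prop
  | block (g : FeynmanGraph) (hg : P g) : BuiltFrom P g 1
  | vertex (g γ : FeynmanGraph) (m n : ℕ) (hg : BuiltFrom P g m) (hγ : BuiltFrom P γ n) (v : g.V)
      (φ : {h : g.H // g.vert h = v} ≃ {k : γ.H // γ.mate k = k}) :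
      BuiltFrom P (insertVertex g v γ φ) (m + n)
  | edge (g γ : FeynmanGraph) (m n : ℕ) (hg : BuiltFrom P g m) (hγ : BuiltFrom P γ n) (e : g.H)
      (a b : γ.H) (he : g.mate e ≠ e) (ha : γ.mate a = a) (hb : γ.mate b = b) (hab : a ≠ b)
      (hval : γ.valence = 2) :
      BuiltFrom P (insertEdge g e γ a b he ha hb hab) (m + n)
  | iso (g g' : FeynmanGraph) (n : ℕ) (hg : BuiltFrom P g n) (i : Iso g g') : BuiltFrom P g' n

/-- `g` is a fish-free graph of coradical degree `n`: it is obtained from a primitive graph by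
`n - 1` insertions of primitive graphs, and none of these `n` primitive graphs is the fish. -/
def IsFishFreeOfCoradicalDegree (g : FeynmanGraph) (n : ℕ) : Prop :=
  BuiltFrom (fun γ => γ.IsPrimitive ∧ ¬ γ.IsFish) g n

end FeynmanGraph

/-! The degree of `T` is at most the largest number `c` of circuits of a decomposition, so it
suffices to bound `c`. Counting the `4|V|` half-edges turns the loop number into `L = |V|` for two
legs and `L = |V| - 1` for four. The invariant `IsFishFreeOfCoradicalDegree.numCircuits_le` then
reads `3c + n ≤ 2L` for propagator type and `3c + n + 1 ≤ 2L` for vertex type. The extra one in the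
second case gives the bound for all `n ≥ 1` in the last claim, and forces `n = 1` when equality
holds.

The invariant survives insertions because loops and coradical degrees add while circuits are
subadditive. A decomposition of the composite graph restricts to the inserted graph; shrinking the
strands of the inserted graph that run between its legs gives a decomposition of the outer graph.
Every circuit of the composite then comes from a circuit of one of the two.

For primitive graphs, a proper set of vertices with at most four half-edges leading out spans a
tree, and a degree count leaves it at most one vertex. Hence a primitive propagator has at most two
vertices. A primitive vertex graph other than the fish has no double edge and no vertex with two
legs: each circuit uses at least six half-edges, and at least eight half-edges lie on open strands,
so `6c + 8 ≤ 4|V|`. -/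

/-! ### Fixed point free involutions and parity -/

theorem even_card_of_involution {α : Type*} [Finite α] (f : α → α) (hf : ∀ x, f (f x) = x)
    (hne : ∀ x, f x ≠ x) : Even (Nat.card α) := by
  classical
  have := Fintype.ofFinite α
  have h : ∑ _x : α, (1 : ZMod 2) = 0 :=
    Finset.sum_involution (fun a _ => f a) (fun _ _ => by decide) (fun a _ _ => hne a)
      (fun _ _ => Finset.mem_univ _) (fun a _ => hf a)
  rw [Finset.sum_const, nsmul_eq_mul, mul_one, Finset.card_univ, ← Nat.card_eq_fintype_card,
    ZMod.natCast_eq_zero_iff_even] at h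
  exact h

theorem exists_involution_of_even_card {α : Type*} [Finite α] (h : Even (Nat.card α)) :
    ∃ f : α → α, (∀ x, f (f x) = x) ∧ ∀ x, f x ≠ x := by
  obtain ⟨m, hm⟩ := h
  have e : α ≃ Fin m ⊕ Fin m := Finite.equivFinOfCardEq hm |>.trans finSumFinEquiv.symm
  refine ⟨fun x => e.symm (e x).swap, fun x => by simp, fun x hx => ?_⟩
  have h := congrArg e hx
  rw [Equiv.apply_symm_apply] at h
  rcases hex : e x with y | y <;> simp [hex] at h

/-- Pair the elements inside each class separately. This serves twice: to pair legs along strands,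
and to show that a decomposition exists. -/
theorem exists_involution_of_even_classes {α : Type*} [Finite α] (s : Setoid α)
    (h : ∀ a, Even (Nat.card {b // s a b})) :
    ∃ f : α → α, (∀ x, f (f x) = x) ∧ (∀ x, f x ≠ x) ∧ ∀ x, s x (f x) := by
  have key : ∀ c : Quotient s, ∃ f : {b // Quotient.mk s b = c} → {b // Quotient.mk s b = c},
      (∀ x, f (f x) = x) ∧ ∀ x, f x ≠ x := by
    intro c
    apply exists_involution_of_even_card
    induction c using Quotient.inductionOn with
    | _ a =>
      rw [Nat.card_congr (Equiv.subtypeEquivRight fun b =>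
        (Quotient.eq (r := s)).trans ⟨s.symm', s.symm'⟩)]
      exact h a
  choose t ht hne using key
  -- An element of the class `c` may be viewed in `c` or in its own class `Quotient.mk s x.1`; the
  -- chosen involution gives the same value either way.
  have aux : ∀ (c) (x : {b // Quotient.mk s b = c}), (t (Quotient.mk s x.1) ⟨x.1, rfl⟩).1
      = (t c x).1 := by
    rintro c ⟨b, rfl⟩
    rfl
  refine ⟨fun b => (t (Quotient.mk s b) ⟨b, rfl⟩).1, fun b => ?_, fun b hb => ?_, fun b => ?_⟩
  · exact (aux (Quotient.mk s b) (t (Quotient.mk s b) ⟨b, rfl⟩)).trans (by rw [ht])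
  · exact hne (Quotient.mk s b) ⟨b, rfl⟩ (Subtype.ext hb)
  · exact s.symm' (Quotient.exact (t (Quotient.mk s b) ⟨b, rfl⟩).2)

theorem card_subtype_add_card_subtype_not {α : Type*} [Finite α] (p : α → Prop) :
    Nat.card {a // p a} + Nat.card {a // ¬ p a} = Nat.card α := by
  classical
  rw [← Nat.card_sum]
  exact Nat.card_congr (Equiv.sumCompl p)

namespace FeynmanGraph

variable {g γ : FeynmanGraph}

/-! ### Half-edge counts and the loop number -/

theorem card_halfEdges (g : FeynmanGraph) : Nat.card g.H = 4 * Nat.card g.V := by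
  rw [← Nat.card_congr (Equiv.sigmaFiberEquiv g.vert), Nat.card_sigma]
  simp [g.four_valent, mul_comm]

theorem mate_injective (g : FeynmanGraph) : Function.Injective g.mate :=
  (show Function.Involutive g.mate from g.mate_mate).injective

theorem two_mul_numEdges_add_valence (g : FeynmanGraph) :
    2 * g.numEdges + g.valence = 4 * Nat.card g.V := by
  have h1 : Even (Nat.card {h : g.H // g.mate h ≠ h}) :=
    even_card_of_involution (fun h => ⟨g.mate h.1, fun e => h.2 (g.mate_injective e)⟩)
      (fun h => Subtype.ext (g.mate_mate _)) (fun h e => h.2 (congrArg Subtype.val e))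
  have h2 := card_subtype_add_card_subtype_not fun h : g.H => g.mate h = h
  rw [card_halfEdges] at h2
  obtain ⟨m, hm⟩ := h1
  change Nat.card {h : g.H // ¬ g.mate h = h} = _ at hm
  unfold numEdges valence
  change 2 * (Nat.card {h : g.H // ¬ g.mate h = h} / 2) + _ = _
  omega

/-- Eliminates the number of edges, so that later bounds involve only vertices and legs. -/
theorem two_mul_loopNumber (g : FeynmanGraph) :
    2 * g.loopNumber = 2 * (Nat.card g.V : ℤ) + 2 - g.valence := by
  have := g.two_mul_numEdges_add_valence
  unfold loopNumber
  omega

/-! ### Strands -/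

theorem strand_pairing (σ : g.Decomposition) (h : g.H) : strand σ h (σ.1 h) :=
  Relation.EqvGen.rel _ _ (Or.inl rfl)

theorem strand_mate (σ : g.Decomposition) (h : g.H) : strand σ h (g.mate h) :=
  Relation.EqvGen.rel _ _ (Or.inr rfl)

/-- The strand relation is the smallest equivalence containing the two elementary moves, so a map
need only be checked on those. -/
theorem strand_lift (σ : g.Decomposition) {α : Type*} (s : Setoid α) (f : g.H → α)
    (hσ : ∀ h, s (f h) (f (σ.1 h))) (hm : ∀ h, s (f h) (f (g.mate h))) {a b : g.H}
    (hab : strand σ a b) : s (f a) (f b) := by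
  have : strand σ ≤ s.comap f := Setoid.eqvGen_le (by
    rintro a b (rfl | rfl)
    exacts [hσ a, hm a])
  exact this hab

/-- On a set closed under both moves, `σ` pairs all half-edges and `mate` pairs those that are not
legs; the legs are the difference of two even numbers. For a single strand this says that open
strands have their ends paired. -/
theorem even_card_legs_of_stable (σ : g.Decomposition) (p : g.H → Prop)
    (hσ : ∀ h, p h → p (σ.1 h)) (hm : ∀ h, p h → p (g.mate h)) :
    Even (Nat.card {h : {h // p h} // g.mate h.1 = h.1}) := by
  have h1 : Even (Nat.card {h // p h}) :=
    even_card_of_involution (fun h => ⟨σ.1 h.1, hσ _ h.2⟩)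
      (fun h => Subtype.ext (σ.2.1 _)) (fun h e => σ.2.2.1 _ (congrArg Subtype.val e))
  have h2 : Even (Nat.card {h : {h // p h} // ¬ g.mate h.1 = h.1}) :=
    even_card_of_involution
      (fun h => ⟨⟨g.mate h.1.1, hm _ h.1.2⟩, fun e => h.2 (g.mate_injective e)⟩)
      (fun h => Subtype.ext (Subtype.ext (g.mate_mate _)))
      (fun h e => h.2 (congrArg (fun x => x.1.1) e))
  have h3 := card_subtype_add_card_subtype_not fun h : {h // p h} => g.mate h.1 = h.1
  rw [← h3] at h1
  exact (Nat.even_add.1 h1).2 h2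

/-- The legs can be paired so that the two legs of a pair lie on the same strand. -/
theorem exists_legPairing (σ : g.Decomposition) :
    ∃ τ : {h : g.H // g.mate h = h} → {h : g.H // g.mate h = h},
      (∀ h, τ (τ h) = h) ∧ (∀ h, τ h ≠ h) ∧ ∀ h, strand σ h.1 (τ h).1 := by
  refine exists_involution_of_even_classes ((strand σ).comap Subtype.val) fun a => ?_
  have h := even_card_legs_of_stable σ (fun h => strand σ a.1 h)
    (fun h hh => (strand σ).trans' hh (strand_pairing σ h))
    (fun h hh => (strand σ).trans' hh (strand_mate σ h))
  refine (Nat.card_congr ?_).symm ▸ h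
  exact ⟨fun x => ⟨⟨x.1.1, x.2⟩, x.1.2⟩, fun x => ⟨⟨x.1.1, x.2⟩, x.1.2⟩, fun _ => rfl, fun _ => rfl⟩

/-- If the strands of `B` are covered by those of `g` and `γ`, in such a way that legs of `g` give
legs of `B` and legs of `γ` are attached to `g`, then every circuit of `B` comes from a circuit of
`g` or `γ`. -/
theorem numCircuits_le_add {B : FeynmanGraph} (σ : B.Decomposition) (σg : g.Decomposition)
    (σγ : γ.Decomposition) (i : g.H → B.H) (j : γ.H → B.H)
    (hiσ : ∀ h, strand σ (i h) (i (σg.1 h))) (him : ∀ h, strand σ (i h) (i (g.mate h)))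
    (hjσ : ∀ k, strand σ (j k) (j (σγ.1 k))) (hjm : ∀ k, strand σ (j k) (j (γ.mate k)))
    (hcover : ∀ x, (∃ h, x = i h) ∨ ∃ k, x = j k)
    (hleg : ∀ h, g.mate h = h → B.mate (i h) = i h)
    (hattach : ∀ k, γ.mate k = k → ∃ h, strand σ (j k) (i h)) :
    numCircuits σ ≤ numCircuits σg + numCircuits σγ := by
  unfold numCircuits
  have : Finite (Quotient (strand σg)) := Quotient.finite _
  have : Finite (Quotient (strand σγ)) := Quotient.finite _
  rw [← Nat.card_sum]
  have hi : ∀ {a b}, strand σg a b → strand σ (i a) (i b) :=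
    fun hab => strand_lift σg (strand σ) i hiσ him hab
  have hj : ∀ {a b}, strand σγ a b → strand σ (j a) (j b) :=
    fun hab => strand_lift σγ (strand σ) j hjσ hjm hab
  let F : Quotient (strand σg) ⊕ Quotient (strand σγ) → Quotient (strand σ) :=
    Sum.elim (Quotient.map i fun _ _ => hi) (Quotient.map j fun _ _ => hj)
  have key : ∀ c : {c : Quotient (strand σ) //
      ∀ h : B.H, Quotient.mk (strand σ) h = c → B.mate h ≠ h},
      ∃ d : {c : Quotient (strand σg) //
        ∀ h : g.H, Quotient.mk (strand σg) h = c → g.mate h ≠ h} ⊕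
        {c : Quotient (strand σγ) // ∀ h : γ.H, Quotient.mk (strand σγ) h = c → γ.mate h ≠ h},
        F (Sum.map Subtype.val Subtype.val d) = c.1 := by
    rintro ⟨c, hc⟩
    -- A circuit that meets the image of `g` comes from `g`. One that avoids it lies entirely in
    -- `γ`, and it cannot contain a leg of `γ`, because such a leg would connect it to `g`.
    by_cases hx : ∃ h, Quotient.mk (strand σ) (i h) = c
    · obtain ⟨h, rfl⟩ := hx
      refine ⟨Sum.inl ⟨Quotient.mk _ h, fun h' e hm => ?_⟩, rfl⟩
      exact hc (i h') (Quotient.sound (hi (Quotient.exact e))) (hleg h' hm)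
    · induction c using Quotient.inductionOn with
      | _ x =>
        rcases hcover x with ⟨h, rfl⟩ | ⟨k, rfl⟩
        · exact absurd ⟨h, rfl⟩ hx
        · refine ⟨Sum.inr ⟨Quotient.mk _ k, fun k' e hm => hx ?_⟩, rfl⟩
          obtain ⟨h, hh⟩ := hattach k' hm
          exact ⟨h, Quotient.sound ((strand σ).trans' ((strand σ).symm' hh)
            (hj (Quotient.exact e)))⟩
  -- `F` recovers a circuit from its chosen source, so `G` is injective.
  choose G hG using key
  refine Nat.card_le_card_of_injective G fun a b hab => Subtype.ext ?_
  rw [← hG a, ← hG b, hab]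

/-! ### Insertion into a vertex -/

section VertexInsertion

variable (v : g.V) (φ : {h : g.H // g.vert h = v} ≃ {k : γ.H // γ.mate k = k})

theorem vertexGlue_injective : Function.Injective (vertexGlue g v γ φ) := by
  intro a b hab
  unfold vertexGlue at hab
  split_ifs at hab with h1 h2 h2
  · have := φ.injective (Subtype.ext (Sum.inr_injective hab))
    exact congrArg Subtype.val this
  · exact congrArg Subtype.val (Sum.inl_injective hab)

theorem vertexGlue_symm (k : {k : γ.H // γ.mate k = k}) :
    vertexGlue g v γ φ (φ.symm k).1 = Sum.inr k.1 := by
  unfold vertexGlue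
  rw [dif_pos (φ.symm k).2]
  simp

theorem valence_insertVertex : (insertVertex g v γ φ).valence = g.valence := by
  refine (Nat.card_congr (Equiv.ofBijective (fun h : {h : g.H // g.mate h = h} =>
    (⟨vertexGlue g v γ φ h.1, (vertexMate_glue g v γ φ h.1).trans (by rw [h.2])⟩ :
      {x // (insertVertex g v γ φ).mate x = x})) ⟨fun a b hab => ?_, ?_⟩)).symm
  · exact Subtype.ext (vertexGlue_injective v φ (congrArg Subtype.val hab))
  · have aux : ∀ h, vertexMate g v γ φ (vertexGlue g v γ φ h) = vertexGlue g v γ φ h →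
        g.mate h = h := fun h hh => by
      rw [vertexMate_glue] at hh
      exact vertexGlue_injective v φ hh
    rintro ⟨x, hx⟩
    change vertexMate g v γ φ x = x at hx
    rcases x with h | k
    · have e : vertexGlue g v γ φ h.1 = Sum.inl h := dif_neg h.2
      rw [← e] at hx
      exact ⟨⟨h.1, aux _ hx⟩, Subtype.ext e⟩
    · by_cases hk : γ.mate k = k
      · have e := vertexGlue_symm v φ ⟨k, hk⟩
        rw [← e] at hx
        exact ⟨⟨_, aux _ hx⟩, Subtype.ext e⟩
      · have e : vertexMate g v γ φ (Sum.inr k) = Sum.inr (γ.mate k) := dif_neg hk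
        rw [e] at hx
        exact absurd (Sum.inr_injective hx) hk

theorem card_vertices_insertVertex :
    Nat.card (insertVertex g v γ φ).V + 1 = Nat.card g.V + Nat.card γ.V := by
  change Nat.card ({u : g.V // ¬ u = v} ⊕ γ.V) + 1 = _
  have h := card_subtype_add_card_subtype_not fun u : g.V => u = v
  rw [Nat.card_sum, ← h, Nat.card_unique (α := {u : g.V // u = v})]
  omega

/-- The strands of `γ` between its legs induce a pairing of the four legs, and hence, through `φ`,
of the four half-edges at `v`. -/
theorem exists_numCircuits_insertVertex_le (σ : (insertVertex g v γ φ).Decomposition) :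
    ∃ (σg : g.Decomposition) (σγ : γ.Decomposition),
      numCircuits σ ≤ numCircuits σg + numCircuits σγ := by
  classical
  have hinl : ∀ h : {h : g.H // g.vert h ≠ v}, ∃ h' : {h : g.H // g.vert h ≠ v},
      σ.1 (Sum.inl h) = Sum.inl h' ∧ g.vert h'.1 = g.vert h.1 := by
    intro h
    have hv := σ.2.2.2 (Sum.inl h)
    generalize σ.1 (Sum.inl h) = y at hv
    rcases y with y | y
    · exact ⟨y, rfl, by simpa [insertVertex, vertexVert] using hv⟩
    · simp [insertVertex, vertexVert] at hv
  have hinr : ∀ k : γ.H, ∃ k' : γ.H, σ.1 (Sum.inr k) = Sum.inr k' ∧ γ.vert k' = γ.vert k := by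
    intro k
    have hv := σ.2.2.2 (Sum.inr k)
    generalize σ.1 (Sum.inr k) = y at hv
    rcases y with y | y
    · simp [insertVertex, vertexVert] at hv
    · exact ⟨y, rfl, by simpa [insertVertex, vertexVert] using hv⟩
  choose a ha hav using hinl
  choose b hb hbv using hinr
  let σγ : γ.Decomposition := ⟨b, fun k => by
      have := σ.2.1 (Sum.inr k)
      rw [hb, hb] at this
      exact Sum.inr_injective this, fun k e => by
      have := hb k
      rw [e] at this
      exact σ.2.2.1 _ this, hbv⟩
  have haa : ∀ h, a (a h) = h := fun h => by
    have := σ.2.1 (Sum.inl h)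
    rw [ha, ha] at this
    exact Sum.inl_injective this
  have hane : ∀ h, a h ≠ h := fun h e => by
    have := ha h
    rw [e] at this
    exact σ.2.2.1 _ this
  obtain ⟨τ, hττ, hτne, hτs⟩ := exists_legPairing σγ
  -- At `v` use the leg pairing `τ` induced by the strands inside `γ`; at all other vertices keep
  -- the pairs of `σ`.
  let f : g.H → g.H := fun h =>
    if hv : g.vert h = v then (φ.symm (τ (φ ⟨h, hv⟩))).1 else (a ⟨h, hv⟩).1
  have fpos : ∀ h (hv : g.vert h = v), f h = (φ.symm (τ (φ ⟨h, hv⟩))).1 := fun h hv => dif_pos hv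
  have fneg : ∀ h (hv : g.vert h ≠ v), f h = (a ⟨h, hv⟩).1 := fun h hv => dif_neg hv
  let σg : g.Decomposition := ⟨f, fun h => by
      by_cases hv : g.vert h = v
      · rw [fpos h hv, fpos _ (φ.symm (τ (φ ⟨h, hv⟩))).2]
        simp [hττ]
      · rw [fneg h hv, fneg _ (a ⟨h, hv⟩).2]
        simp [haa], fun h e => by
      by_cases hv : g.vert h = v
      · rw [fpos h hv] at e
        refine hτne (φ ⟨h, hv⟩) (φ.symm.injective (Subtype.ext ?_))
        rw [e]
        simp
      · rw [fneg h hv] at e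
        exact hane ⟨h, hv⟩ (Subtype.ext e), fun h => by
      by_cases hv : g.vert h = v
      · rw [fpos h hv, hv]
        exact (φ.symm (τ (φ ⟨h, hv⟩))).2
      · rw [fneg h hv]
        exact hav ⟨h, hv⟩⟩
  have hjσ : ∀ k, strand σ (Sum.inr k) (Sum.inr (b k)) := fun k => by
    have := strand_pairing σ (Sum.inr k)
    rwa [hb] at this
  have hjm : ∀ k, strand σ (Sum.inr k) (Sum.inr (γ.mate k)) := fun k => by
    by_cases hk : γ.mate k = k
    · rw [hk]
      exact (strand σ).refl' _
    · have := strand_mate σ (Sum.inr k)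
      have e : (insertVertex g v γ φ).mate (Sum.inr k) = Sum.inr (γ.mate k) := dif_neg hk
      rwa [e] at this
  refine ⟨σg, σγ, numCircuits_le_add σ σg σγ (vertexGlue g v γ φ) Sum.inr (fun h => ?_)
    (fun h => ?_) hjσ hjm (fun x => ?_) (fun h hh => ?_) (fun k hk => ?_)⟩
  · change strand σ (vertexGlue g v γ φ h) (vertexGlue g v γ φ (f h))
    by_cases hv : g.vert h = v
    · have e : vertexGlue g v γ φ h = Sum.inr (φ ⟨h, hv⟩).1 := dif_pos hv
      rw [fpos h hv, vertexGlue_symm, e]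
      exact strand_lift σγ (strand σ) Sum.inr hjσ hjm (hτs _)
    · have e : vertexGlue g v γ φ h = Sum.inl ⟨h, hv⟩ := dif_neg hv
      have e' : vertexGlue g v γ φ (a ⟨h, hv⟩).1 = Sum.inl (a ⟨h, hv⟩) := dif_neg (a ⟨h, hv⟩).2
      rw [fneg h hv, e', e, ← ha]
      exact strand_pairing σ _
  · have := strand_mate σ (vertexGlue g v γ φ h)
    rwa [show (insertVertex g v γ φ).mate _ = _ from vertexMate_glue g v γ φ h] at this
  · rcases x with h | k
    · exact Or.inl ⟨h.1, (show vertexGlue g v γ φ h.1 = Sum.inl h from dif_neg h.2).symm⟩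
    · exact Or.inr ⟨k, rfl⟩
  · exact (vertexMate_glue g v γ φ h).trans (by rw [hh])
  · refine ⟨(φ.symm ⟨k, hk⟩).1, ?_⟩
    rw [vertexGlue_symm]
    exact (strand σ).refl' _

end VertexInsertion

/-! ### Insertion into an edge -/

theorem eq_or_eq_of_valence_eq_two {a b : g.H} (hval : g.valence = 2) (hab : a ≠ b)
    (ha : g.mate a = a) (hb : g.mate b = b) (k : g.H) (hk : g.mate k = k) : k = a ∨ k = b := by
  by_contra! hne
  classical
  have := Fintype.ofFinite {h : g.H // g.mate h = h}
  have h3 : ({⟨a, ha⟩, ⟨b, hb⟩, ⟨k, hk⟩} : Finset {h : g.H // g.mate h = h}).card = 3 := by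
    rw [Finset.card_eq_three]
    exact ⟨_, _, _, by simpa using hab, by simpa using hne.1.symm, by simpa using hne.2.symm, rfl⟩
  have := Finset.card_le_univ ({⟨a, ha⟩, ⟨b, hb⟩, ⟨k, hk⟩} : Finset {h : g.H // g.mate h = h})
  rw [h3, ← Nat.card_eq_fintype_card] at this
  unfold valence at hval
  omega

section EdgeInsertion

variable (e : g.H) (a b : γ.H) (he : g.mate e ≠ e) (ha : γ.mate a = a) (hb : γ.mate b = b)
  (hab : a ≠ b)

theorem card_vertices_insertEdge :
    Nat.card (insertEdge g e γ a b he ha hb hab).V = Nat.card g.V + Nat.card γ.V :=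
  Nat.card_sum

theorem edgeMate_inl_of_leg (he : g.mate e ≠ e) (h : g.H) (hh : g.mate h = h) :
    edgeMate g e γ a b (Sum.inl h) = Sum.inl h := by
  have h1 : h ≠ e := fun h1 => he (h1 ▸ hh)
  have h2 : h ≠ g.mate e := fun h2 => by
    rw [h2, g.mate_mate] at hh
    exact he hh.symm
  simp [edgeMate, h1, h2, hh]

theorem valence_insertEdge (hval : γ.valence = 2) :
    (insertEdge g e γ a b he ha hb hab).valence = g.valence := by
  refine (Nat.card_congr (Equiv.ofBijective (fun h : {h : g.H // g.mate h = h} =>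
    (⟨Sum.inl h.1, edgeMate_inl_of_leg e a b he h.1 h.2⟩ :
      {x // (insertEdge g e γ a b he ha hb hab).mate x = x})) ⟨fun h k hk => ?_, ?_⟩)).symm
  · exact Subtype.ext (Sum.inl_injective (congrArg Subtype.val hk))
  · rintro ⟨x, hx⟩
    change edgeMate g e γ a b x = x at hx
    rcases x with h | k
    · refine ⟨⟨h, ?_⟩, rfl⟩
      simp only [edgeMate] at hx
      split_ifs at hx
      exact Sum.inl_injective hx
    · exfalso
      simp only [edgeMate] at hx
      split_ifs at hx with h1 h2
      rcases eq_or_eq_of_valence_eq_two hval hab ha hb k (Sum.inr_injective hx) with h | h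
      exacts [h1 h, h2 h]

/-- With only two legs, `γ` has a single open strand, which plays the role of the edge it replaces.
-/
theorem exists_numCircuits_insertEdge_le (hval : γ.valence = 2)
    (σ : (insertEdge g e γ a b he ha hb hab).Decomposition) :
    ∃ (σg : g.Decomposition) (σγ : γ.Decomposition),
      numCircuits σ ≤ numCircuits σg + numCircuits σγ := by
  have hinl : ∀ h : g.H, ∃ h' : g.H, σ.1 (Sum.inl h) = Sum.inl h' ∧ g.vert h' = g.vert h := by
    intro h
    have hv := σ.2.2.2 (Sum.inl h)
    generalize σ.1 (Sum.inl h) = y at hv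
    rcases y with y | y
    · exact ⟨y, rfl, by simpa [insertEdge] using hv⟩
    · simp [insertEdge] at hv
  have hinr : ∀ k : γ.H, ∃ k' : γ.H, σ.1 (Sum.inr k) = Sum.inr k' ∧ γ.vert k' = γ.vert k := by
    intro k
    have hv := σ.2.2.2 (Sum.inr k)
    generalize σ.1 (Sum.inr k) = y at hv
    rcases y with y | y
    · simp [insertEdge] at hv
    · exact ⟨y, rfl, by simpa [insertEdge] using hv⟩
  choose s hs hsv using hinl
  choose t ht htv using hinr
  let σg : g.Decomposition := ⟨s, fun h => by
      have := σ.2.1 (Sum.inl h)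
      rw [hs, hs] at this
      exact Sum.inl_injective this, fun h e => by
      have := hs h
      rw [e] at this
      exact σ.2.2.1 _ this, hsv⟩
  let σγ : γ.Decomposition := ⟨t, fun k => by
      have := σ.2.1 (Sum.inr k)
      rw [ht, ht] at this
      exact Sum.inr_injective this, fun k e => by
      have := ht k
      rw [e] at this
      exact σ.2.2.1 _ this, htv⟩
  have hiσ : ∀ h, strand σ (Sum.inl h) (Sum.inl (s h)) := fun h => by
    have := strand_pairing σ (Sum.inl h)
    rwa [hs] at this
  have hjσ : ∀ k, strand σ (Sum.inr k) (Sum.inr (t k)) := fun k => by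
    have := strand_pairing σ (Sum.inr k)
    rwa [ht] at this
  have hlegs := eq_or_eq_of_valence_eq_two hval hab ha hb
  have hjm : ∀ k, strand σ (Sum.inr k) (Sum.inr (γ.mate k)) := fun k => by
    by_cases hk : γ.mate k = k
    · rw [hk]
      exact (strand σ).refl' _
    · have h := strand_mate σ (Sum.inr k)
      have e : (insertEdge g e γ a b he ha hb hab).mate (Sum.inr k) = Sum.inr (γ.mate k) := by
        change edgeMate g e γ a b (Sum.inr k) = _
        have h1 : k ≠ a := fun h1 => hk (h1 ▸ ha)
        have h2 : k ≠ b := fun h2 => hk (h2 ▸ hb)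
        simp [edgeMate, h1, h2]
      rwa [e] at h
  have hea : strand σ (Sum.inl e) (Sum.inr a) := by
    have h := strand_mate σ (Sum.inl e)
    rwa [show (insertEdge g e γ a b he ha hb hab).mate (Sum.inl e) = Sum.inr a by
      simp [insertEdge, edgeMate]] at h
  have heb : strand σ (Sum.inl (g.mate e)) (Sum.inr b) := by
    have h := strand_mate σ (Sum.inl (g.mate e))
    rwa [show (insertEdge g e γ a b he ha hb hab).mate (Sum.inl (g.mate e)) = Sum.inr b by
      simp [insertEdge, edgeMate, he]] at h
  -- The leg paired with `a` along its strand must be the only other leg, `b`.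
  have hab' : strand σ (Sum.inr a) (Sum.inr b) := by
    obtain ⟨τ, -, hτne, hτs⟩ := exists_legPairing σγ
    have h : (τ ⟨a, ha⟩).1 = b := (hlegs _ (τ ⟨a, ha⟩).2).resolve_left
      fun h => hτne ⟨a, ha⟩ (Subtype.ext h)
    have h' := hτs ⟨a, ha⟩
    rw [h] at h'
    exact strand_lift σγ (strand σ) Sum.inr hjσ hjm h'
  have hem : strand σ (Sum.inl e) (Sum.inl (g.mate e)) :=
    (strand σ).trans' hea ((strand σ).trans' hab' ((strand σ).symm' heb))
  refine ⟨σg, σγ, numCircuits_le_add σ σg σγ Sum.inl Sum.inr hiσ (fun h => ?_) hjσ hjm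
    (fun x => ?_) (edgeMate_inl_of_leg e a b he) (fun k hk => ?_)⟩
  · by_cases h1 : h = e
    · rw [h1]
      exact hem
    by_cases h2 : h = g.mate e
    · rw [h2, g.mate_mate]
      exact (strand σ).symm' hem
    have h3 := strand_mate σ (Sum.inl h)
    rwa [show (insertEdge g e γ a b he ha hb hab).mate (Sum.inl h) = Sum.inl (g.mate h) by
      simp [insertEdge, edgeMate, h1, h2]] at h3
  · rcases x with h | k
    exacts [Or.inl ⟨h, rfl⟩, Or.inr ⟨k, rfl⟩]
  · rcases hlegs k hk with rfl | rfl
    exacts [⟨_, (strand σ).symm' hea⟩, ⟨_, (strand σ).symm' heb⟩]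

end EdgeInsertion

/-! ### Isomorphic graphs -/

section Iso

variable {g' : FeynmanGraph}

theorem Iso.mate_eq_iff (i : Iso g g') (h : g.H) : g'.mate (i.onH h) = i.onH h ↔ g.mate h = h := by
  rw [i.mate_comm, i.onH.apply_eq_iff_eq]

theorem Iso.valence_eq (i : Iso g g') : g'.valence = g.valence :=
  (Nat.card_congr (i.onH.subtypeEquiv fun h => (i.mate_eq_iff h).symm)).symm

theorem Iso.card_vertices_eq (i : Iso g g') : Nat.card g'.V = Nat.card g.V :=
  (Nat.card_congr i.onV).symm

theorem Iso.loopNumber_eq (i : Iso g g') : g'.loopNumber = g.loopNumber := by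
  have h1 := g.two_mul_loopNumber
  have h2 := g'.two_mul_loopNumber
  rw [i.card_vertices_eq, i.valence_eq] at h2
  omega

theorem Iso.exists_numCircuits_le (i : Iso g g') (σ : g'.Decomposition) :
    ∃ σg : g.Decomposition, numCircuits σ ≤ numCircuits σg := by
  let σg : g.Decomposition := ⟨fun h => i.onH.symm (σ.1 (i.onH h)),
    fun h => by simp [σ.2.1], fun h e => σ.2.2.1 (i.onH h) (by
      rw [Equiv.symm_apply_eq] at e
      exact e), fun h => by
      apply i.onV.injective
      rw [← i.vert_comm, ← i.vert_comm, Equiv.apply_symm_apply, σ.2.2.2]⟩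
  have key : ∀ {a b}, strand σ a b → strand σg (i.onH.symm a) (i.onH.symm b) := by
    intro a b hab
    refine strand_lift σ (strand σg) i.onH.symm (fun h => ?_) (fun h => ?_) hab
    · have := strand_pairing σg (i.onH.symm h)
      simpa [σg] using this
    · have e : i.onH.symm (g'.mate h) = g.mate (i.onH.symm h) := by
        rw [Equiv.symm_apply_eq, ← i.mate_comm, Equiv.apply_symm_apply]
      rw [e]
      exact strand_mate σg (i.onH.symm h)
  have key' : ∀ {a b}, strand σg a b → strand σ (i.onH a) (i.onH b) := by
    intro a b hab
    refine strand_lift σg (strand σ) i.onH (fun h => ?_) (fun h => ?_) hab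
    · have := strand_pairing σ (i.onH h)
      simpa [σg] using this
    · rw [← i.mate_comm h]
      exact strand_mate σ (i.onH h)
  refine ⟨σg, ?_⟩
  have : Finite (Quotient (strand σg)) := Quotient.finite _
  refine Nat.card_le_card_of_injective
    (fun c => ⟨Quotient.map i.onH.symm (fun _ _ => key) c.1, ?_⟩) ?_
  · rcases c with ⟨c, hc⟩
    induction c using Quotient.inductionOn with
    | _ a =>
      intro h hh hm
      refine hc (i.onH h) ?_ ((i.mate_eq_iff h).2 hm)
      have := key' (Quotient.exact hh)
      rw [Equiv.apply_symm_apply] at this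
      exact Quotient.sound this
  · rintro ⟨c, hc⟩ ⟨d, hd⟩ hcd
    refine Subtype.ext ?_
    have hcd' := congrArg Subtype.val hcd
    clear hcd
    induction c, d using Quotient.inductionOn₂ with
    | _ a b =>
      have := key' (Quotient.exact hcd')
      simp only [Equiv.apply_symm_apply] at this
      exact Quotient.sound this

theorem Iso.connectedVia (i : Iso g g') {W : Set g.V} {S : Set g.H} {W' : Set g'.V} {S' : Set g'.H}
    (hW : ∀ u, i.onV u ∈ W' ↔ u ∈ W) (hS : ∀ h, h ∈ S → i.onH h ∈ S') (h : g.ConnectedVia W S) :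
    g'.ConnectedVia W' S' := by
  obtain ⟨⟨w, hw⟩, hc⟩ := h
  refine ⟨⟨i.onV w, (hW w).2 hw⟩, fun u hu v hv => ?_⟩
  have h := hc (i.onV.symm u) ((hW _).1 (by simpa using hu)) (i.onV.symm v)
    ((hW _).1 (by simpa using hv))
  have h' : Relation.ReflTransGen (fun a b => ∃ h ∈ S', g'.vert h = a ∧ g'.vert (g'.mate h) = b)
      (i.onV (i.onV.symm u)) (i.onV (i.onV.symm v)) :=
    Relation.ReflTransGen.lift i.onV (by
      rintro a b ⟨h, hh, rfl, rfl⟩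
      exact ⟨i.onH h, hS h hh, i.vert_comm h, by rw [i.mate_comm, i.vert_comm]⟩) _ _ h
  simpa using h'

theorem Iso.isOnePI (i : Iso g g') (h : g.IsOnePI) : g'.IsOnePI := by
  refine ⟨i.connectedVia (by simp) (fun h hh => ?_) h.1, fun e he => ?_⟩
  · exact fun hm => hh ((i.mate_eq_iff h).1 hm)
  · obtain ⟨e, rfl⟩ := i.onH.surjective e
    refine i.connectedVia (by simp) (fun k hk => ?_)
      (h.2 e fun hm => he ((i.mate_eq_iff e).2 hm))
    refine ⟨fun hm => hk.1 ((i.mate_eq_iff k).1 hm), ?_⟩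
    have := hk.2
    simpa [i.mate_comm] using this

/-- The preimage of a subgraph under an isomorphism. -/
def Iso.comap (i : Iso g g') (γ : g'.Subgraph) : g.Subgraph where
  verts := i.onV ⁻¹' γ.verts
  halfEdges := i.onH ⁻¹' γ.halfEdges
  nonempty := γ.nonempty.preimage i.onV.surjective
  internal h hh hm := γ.internal _ hh ((i.mate_eq_iff h).2 hm)
  mate_mem h hh := by
    have := γ.mate_mem _ hh
    rwa [i.mate_comm] at this
  vert_mem h hh := by
    have := γ.vert_mem _ hh
    rwa [i.vert_comm] at this

/-- Needed because a graph of coradical degree one may be given only up to isomorphism with a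
primitive block. -/
theorem Iso.isPrimitive (i : Iso g g') (h : g.IsPrimitive) : g'.IsPrimitive := by
  obtain ⟨h1, h2, h3, h4, h5⟩ := h
  refine ⟨i.isOnePI h1, by rwa [i.loopNumber_eq], by rwa [i.valence_eq], ?_, fun γ hp hv => ?_⟩
  · rintro ⟨h, hm, hh⟩
    obtain ⟨h, rfl⟩ := i.onH.surjective h
    rw [i.mate_comm, i.vert_comm, i.vert_comm, i.onV.apply_eq_iff_eq] at hh
    exact h4 ⟨h, fun e => hm ((i.mate_eq_iff h).2 e), hh⟩
  · have hV := Set.ncard_preimage_of_injective_subset_range (s := γ.verts) i.onV.injective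
      (by simp)
    have hE := Set.ncard_preimage_of_injective_subset_range (s := γ.halfEdges) i.onH.injective
      (by simp)
    have hcp : (i.comap γ).IsProper := by
      rintro ⟨ha, hb⟩
      refine hp ⟨Set.eq_univ_of_forall fun v => ?_, Set.ext fun h => ?_⟩
      · obtain ⟨v, rfl⟩ := i.onV.surjective v
        exact Set.eq_univ_iff_forall.1 ha v
      · obtain ⟨h, rfl⟩ := i.onH.surjective h
        have := Set.ext_iff.1 hb h
        simpa [Iso.comap, i.mate_eq_iff] using this
    have hcv : (i.comap γ).valence < 6 := by
      have : {h | g.vert h ∈ (i.comap γ).verts ∧ h ∉ (i.comap γ).halfEdges} =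
          i.onH ⁻¹' {h | g'.vert h ∈ γ.verts ∧ h ∉ γ.halfEdges} := by
        ext h
        simp [Iso.comap, i.vert_comm]
      unfold Subgraph.valence
      rw [this, Set.ncard_preimage_of_injective_subset_range i.onH.injective (by simp)]
      exact hv
    rcases h5 (i.comap γ) hcp hcv with ht | ht
    · refine Or.inl ⟨i.connectedVia (fun _ => Iff.rfl) (fun _ hh => hh) ht.1, ?_⟩
      have := ht.2
      simp only [Iso.comap] at this
      rwa [hV, hE] at this
    · obtain ⟨h, a, b, c, d⟩ := ht
      refine Or.inr ⟨i.onH h, fun e => a ((i.mate_eq_iff h).1 e), b, ?_, ?_⟩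
      · rw [i.vert_comm]
        exact c
      · rw [i.mate_comm, i.vert_comm]
        exact d

end Iso

/-! ### Primitive graphs -/

/-- The subgraph with vertices `W` and all internal edges between them. -/
def inducedSubgraph (g : FeynmanGraph) (W : Set g.V) (hW : W.Nonempty) : g.Subgraph where
  verts := W
  halfEdges := {h | g.mate h ≠ h ∧ g.vert h ∈ W ∧ g.vert (g.mate h) ∈ W}
  nonempty := hW
  internal h hh := hh.1
  mate_mem h hh := ⟨by rw [g.mate_mate]; exact hh.1.symm, hh.2.2, by rw [g.mate_mate]; exact hh.2.1⟩
  vert_mem h hh := hh.2.1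

theorem ncard_fiber (g : FeynmanGraph) (v : g.V) : {h | g.vert h = v}.ncard = 4 := by
  rw [← g.four_valent v]
  exact Nat.card_coe_set_eq _ |>.symm

theorem ncard_preimage_vert (g : FeynmanGraph) (W : Set g.V) :
    (g.vert ⁻¹' W).ncard = 4 * W.ncard := by
  have := Fintype.ofFinite W
  rw [← Nat.card_coe_set_eq, ← Nat.card_coe_set_eq,
    ← Nat.card_congr (Equiv.sigmaFiberEquiv (fun h : g.vert ⁻¹' W => (⟨g.vert h.1, h.2⟩ : W))),
    Nat.card_sigma]
  have : ∀ w : W, Nat.card {h : g.vert ⁻¹' W // (⟨g.vert h.1, h.2⟩ : W) = w} = 4 := fun w => by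
    rw [← g.four_valent w.1]
    exact Nat.card_congr ⟨fun h => ⟨h.1.1, congrArg Subtype.val h.2⟩,
      fun h => ⟨⟨h.1, by rw [Set.mem_preimage, h.2]; exact w.2⟩, Subtype.ext h.2⟩,
      fun _ => rfl, fun _ => rfl⟩
  simp [this, mul_comm]

/-- A set of vertices of a primitive graph, not all of them, from which at most four half-edges
lead outside spans a tree, so that its size is bounded by the number of these half-edges. -/
theorem IsPrimitive.two_mul_ncard_lt_boundary_or_eq_zero (h : g.IsPrimitive) {W : Set g.V}
    (hW : W ≠ Set.univ)
    (hout : {h | g.vert h ∈ W ∧ (g.mate h = h ∨ g.vert (g.mate h) ∉ W)}.ncard ≤ 4) :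
    2 * W.ncard + 1 ≤ {h | g.vert h ∈ W ∧ (g.mate h = h ∨ g.vert (g.mate h) ∉ W)}.ncard ∨
      W.ncard = 0 := by
  rcases W.eq_empty_or_nonempty with rfl | hne
  · simp
  have hset : {h | g.vert h ∈ W ∧ (g.mate h = h ∨ g.vert (g.mate h) ∉ W)} =
      g.vert ⁻¹' W \ (g.inducedSubgraph W hne).halfEdges := by
    ext h
    simp only [inducedSubgraph, Set.mem_ofPred_eq, Set.mem_sdiff, Set.mem_preimage]
    tauto
  have hsub : (g.inducedSubgraph W hne).halfEdges ⊆ g.vert ⁻¹' W := fun h hh => hh.2.1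
  have hcard := Set.ncard_sdiff_add_ncard_of_subset hsub
  rw [ncard_preimage_vert, ← hset] at hcard
  have hval : (g.inducedSubgraph W hne).valence =
      {h | g.vert h ∈ W ∧ (g.mate h = h ∨ g.vert (g.mate h) ∉ W)}.ncard := by
    rw [hset]
    rfl
  rcases h.2.2.2.2 (g.inducedSubgraph W hne) (fun hc => hW hc.1) (by omega) with ht | ht
  -- A tree on `W` has `|W| - 1` edges, so exactly `2|W| + 2` half-edges lead out. The rounded
  -- division, without evenness of the half-edge count, yields only `2|W| + 1`, which suffices.
  · have h2 : _ / 2 + 1 = W.ncard := ht.2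
    omega
  -- An induced subgraph omits no internal edge between its vertices, so its contraction creates no
  -- self-loop.
  · obtain ⟨h, a, b, c, d⟩ := ht
    exact absurd ⟨a, c, d⟩ b

/-! ### Counting the half-edges on strands -/

/-- Whenever a strand meets a vertex, it contains both half-edges of a pair there. -/
theorem two_mul_card_vertices_le_strand (σ : g.Decomposition) (h : g.H) (s : Finset g.V)
    (hs : ∀ v ∈ s, ∃ x, strand σ h x ∧ g.vert x = v) :
    2 * s.card ≤ {x | strand σ h x}.ncard := by
  classical
  let S : Finset g.H := Finset.univ.filter fun x => strand σ h x
  have hS : {x | strand σ h x}.ncard = S.card := by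
    rw [← Set.ncard_coe_finset]
    simp [S]
  have h1 : 2 * (S.image g.vert).card ≤ S.card := by
    refine Finset.mul_card_image_le_card S 2 fun v hv => ?_
    obtain ⟨x, hx, rfl⟩ := Finset.mem_image.1 hv
    have hx' : strand σ h x := (Finset.mem_filter.1 hx).2
    refine Finset.one_lt_card.2 ⟨x, by simp [hx], σ.1 x, ?_, (σ.2.2.1 x).symm⟩
    simp only [S, Finset.mem_filter, Finset.mem_univ, true_and]
    exact ⟨(strand σ).trans' hx' (strand_pairing σ x), σ.2.2.2 x⟩
  have h2 : s ⊆ S.image g.vert := fun v hv => by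
    obtain ⟨x, hx, rfl⟩ := hs v hv
    exact Finset.mem_image_of_mem _ (by simpa [S] using hx)
  have := Finset.card_le_card h2
  omega

/-- Circuits are disjoint sets of at least `m` half-edges, and all of them avoid `T`, whose elements
lie on open strands. -/
theorem mul_numCircuits_add_ncard_le (σ : g.Decomposition) (m : ℕ) (T : Set g.H)
    (hT : ∀ h ∈ T, ∃ l, strand σ h l ∧ g.mate l = l)
    (hm : ∀ h, (∀ l, strand σ h l → g.mate l ≠ l) → m ≤ {x | strand σ h x}.ncard) :
    m * numCircuits σ + T.ncard ≤ 4 * Nat.card g.V := by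
  classical
  let S : Finset g.H := Finset.univ.filter fun h => ∀ l, strand σ h l → g.mate l ≠ l
  have hc : numCircuits σ = (S.image (Quotient.mk (strand σ))).card := by
    refine Nat.subtype_card _ fun c => ?_
    induction c using Quotient.inductionOn with
    | _ a =>
      simp only [S, Finset.mem_image, Finset.mem_filter, Finset.mem_univ, true_and]
      constructor
      · rintro ⟨b, hb, hba⟩ h hh
        exact hb h (Quotient.exact (hba.trans hh.symm))
      · exact fun h => ⟨a, fun l hl => h l (Quotient.sound ((strand σ).symm' hl)), rfl⟩
  have h1 : m * (S.image (Quotient.mk (strand σ))).card ≤ S.card := by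
    refine Finset.mul_card_image_le_card S m fun c hc => ?_
    obtain ⟨a, ha, rfl⟩ := Finset.mem_image.1 hc
    have ha' := (Finset.mem_filter.1 ha).2
    refine (hm a ha').trans (le_of_eq ?_)
    rw [← Set.ncard_coe_finset]
    congr 1
    ext x
    simp only [S, Finset.coe_filter, Finset.mem_filter, Finset.mem_univ, true_and,
      Set.mem_ofPred_eq]
    constructor
    · exact fun hx => ⟨fun l hl => ha' l ((strand σ).trans' hx hl),
        Quotient.sound ((strand σ).symm' hx)⟩
    · exact fun hx => (strand σ).symm' (Quotient.exact hx.2)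
  have h2 : Disjoint (S : Set g.H) T := by
    rw [Set.disjoint_left]
    intro h hh ht
    obtain ⟨l, hl, hl'⟩ := hT h ht
    exact (Finset.mem_filter.1 hh).2 l hl hl'
  have h3 := Set.ncard_union_eq h2 (Set.toFinite _) (Set.toFinite _)
  have h4 := Set.ncard_le_card ((S : Set g.H) ∪ T)
  rw [card_halfEdges, h3, Set.ncard_coe_finset] at h4
  rw [hc]
  omega

/-! ### Circuits of primitive graphs -/

theorem four_le_ncard_strand (hloop : ¬ g.HasSelfLoop) (σ : g.Decomposition) (h : g.H)
    (hh : g.mate h ≠ h) : 4 ≤ {x | strand σ h x}.ncard := by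
  classical
  have hne : g.vert h ≠ g.vert (g.mate h) := fun e => hloop ⟨h, hh, e.symm⟩
  have := two_mul_card_vertices_le_strand σ h {g.vert h, g.vert (g.mate h)} (by
    intro v hv
    rcases Finset.mem_insert.1 hv with rfl | hv
    · exact ⟨h, (strand σ).refl' h, rfl⟩
    · exact ⟨g.mate h, strand_mate σ h, (Finset.mem_singleton.1 hv).symm⟩)
  rwa [Finset.card_pair hne] at this

/-- Two successive edges of a circuit reach three distinct vertices when there are neither
self-loops nor double edges. -/
theorem six_le_ncard_strand (hloop : ¬ g.HasSelfLoop)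
    (hdouble : ∀ h k, g.mate h ≠ h → g.vert h = g.vert k →
      g.vert (g.mate h) = g.vert (g.mate k) → h = k)
    (σ : g.Decomposition) (h : g.H) (hh : ∀ l, strand σ h l → g.mate l ≠ l) :
    6 ≤ {x | strand σ h x}.ncard := by
  classical
  have h1 := hh h ((strand σ).refl' h)
  have s2 : strand σ h (g.mate h) := strand_mate σ h
  have s3 : strand σ h (σ.1 (g.mate h)) := (strand σ).trans' s2 (strand_pairing σ _)
  have s4 : strand σ h (g.mate (σ.1 (g.mate h))) := (strand σ).trans' s3 (strand_mate σ _)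
  have h3 := hh _ s3
  have v3 : g.vert (σ.1 (g.mate h)) = g.vert (g.mate h) := σ.2.2.2 _
  have n12 : g.vert h ≠ g.vert (g.mate h) := fun e => hloop ⟨h, h1, e.symm⟩
  have n24 : g.vert (g.mate h) ≠ g.vert (g.mate (σ.1 (g.mate h))) := fun e =>
    hloop ⟨_, h3, e.symm.trans v3.symm⟩
  -- If the second edge returned to the start, it would be parallel to the first; by `hdouble` the
  -- two half-edges paired at the middle vertex would coincide.
  have n14 : g.vert h ≠ g.vert (g.mate (σ.1 (g.mate h))) := fun e => by
    refine σ.2.2.1 (g.mate h) (hdouble _ _ h3 v3 ?_)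
    rw [g.mate_mate]
    exact e.symm
  have := two_mul_card_vertices_le_strand σ h
    {g.vert h, g.vert (g.mate h), g.vert (g.mate (σ.1 (g.mate h)))} (by
    intro v hv
    simp only [Finset.mem_insert, Finset.mem_singleton] at hv
    rcases hv with rfl | rfl | rfl
    · exact ⟨h, (strand σ).refl' h, rfl⟩
    · exact ⟨_, s2, rfl⟩
    · exact ⟨_, s4, rfl⟩)
  rwa [Finset.card_eq_three.2 ⟨_, _, _, n12, n14, n24, rfl⟩] at this

/-- If `u` carries `k` legs, then `g.valence - k` legs lie elsewhere, and at most `4 - k` edges run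
from `u` to the rest. -/
theorem ncard_boundary_compl_singleton_le (g : FeynmanGraph) (u : g.V) :
    {h | g.vert h ∈ ({u}ᶜ : Set g.V) ∧ (g.mate h = h ∨ g.vert (g.mate h) ∉ ({u}ᶜ : Set g.V))}.ncard
      + 2 * {h | g.vert h = u ∧ g.mate h = h}.ncard ≤ g.valence + 4 := by
  have h1 : {h | g.vert h ≠ u ∧ g.mate h = h}.ncard + {h | g.vert h = u ∧ g.mate h = h}.ncard
      = g.valence := by
    rw [← Set.ncard_union_eq (Set.disjoint_left.2 fun h a b => a.1 b.1) (Set.toFinite _)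
      (Set.toFinite _)]
    unfold valence
    rw [← Nat.card_coe_set_eq]
    refine Nat.card_congr (Equiv.subtypeEquivRight fun h => ?_)
    simp only [Set.mem_union, Set.mem_ofPred_eq]
    tauto
  have h2 : {h | g.vert h ≠ u ∧ g.vert (g.mate h) = u}.ncard
      + {h | g.vert h = u ∧ g.mate h = h}.ncard ≤ 4 := by
    rw [← Set.ncard_image_of_injective _ g.mate_injective, ← Set.ncard_union_eq ?_ (Set.toFinite _)
      (Set.toFinite _), ← g.ncard_fiber u]
    · refine Set.ncard_le_ncard ?_ (Set.toFinite _)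
      rintro _ (⟨h, hh, rfl⟩ | hh)
      exacts [hh.2, hh.1]
    · rw [Set.disjoint_left]
      rintro _ ⟨h, hh, rfl⟩ hk
      have := hk.2
      rw [g.mate_mate] at this
      exact hh.1 (this.symm ▸ hh.2)
  have h3 : {h | g.vert h ∈ ({u}ᶜ : Set g.V) ∧
      (g.mate h = h ∨ g.vert (g.mate h) ∉ ({u}ᶜ : Set g.V))} ⊆
      {h | g.vert h ≠ u ∧ g.mate h = h} ∪ {h | g.vert h ≠ u ∧ g.vert (g.mate h) = u} := by
    rintro h ⟨a, b | b⟩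
    · exact Or.inl ⟨a, b⟩
    · exact Or.inr ⟨a, not_not.1 b⟩
  have h4 := (Set.ncard_le_ncard h3 (Set.toFinite _)).trans (Set.ncard_union_le _ _)
  omega

theorem ncard_compl_singleton_add_one (g : FeynmanGraph) (u : g.V) :
    ({u}ᶜ : Set g.V).ncard + 1 = Nat.card g.V := by
  rw [← Set.ncard_add_ncard_compl ({u} : Set g.V), Set.ncard_singleton, add_comm]

/-- If half of the legs of a primitive graph are at one vertex, then it has at most two vertices. -/
theorem IsPrimitive.card_vertices_add_le (h : g.IsPrimitive) {u : g.V}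
    (hu : g.valence ≤ 2 * {h | g.vert h = u ∧ g.mate h = h}.ncard) : Nat.card g.V ≤ 2 := by
  have h1 := g.ncard_boundary_compl_singleton_le u
  have h2 := g.ncard_compl_singleton_add_one u
  -- At most four half-edges leave the complement `W` of `u`, so `2|W| + 1 ≤ 4` and `|W| ≤ 1`.
  have h3 := h.two_mul_ncard_lt_boundary_or_eq_zero (W := {u}ᶜ)
    (fun e => (e.symm ▸ Set.mem_univ u : u ∈ ({u}ᶜ : Set g.V)) rfl) (by omega)
  omega

/-- The ends of a double edge have at most `8 - 4` half-edges leading out. Two vertices would then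
form a proper set spanning a tree, giving `5 ≤ 4`. -/
theorem IsPrimitive.not_double_edge (hg : g.IsPrimitive) (hV : 3 ≤ Nat.card g.V) (h k : g.H)
    (hh : g.mate h ≠ h) (h1 : g.vert h = g.vert k)
    (h2 : g.vert (g.mate h) = g.vert (g.mate k)) : h = k := by
  by_contra hne
  have hab : g.vert h ≠ g.vert (g.mate h) := fun e => hg.2.2.2.1 ⟨h, hh, e.symm⟩
  let W : Set g.V := {g.vert h, g.vert (g.mate h)}
  have hW : W.ncard = 2 := Set.ncard_pair hab
  have hWu : W ≠ Set.univ := fun e => by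
    rw [e, Set.ncard_univ] at hW
    omega
  have hD : ({h, k} ∪ {g.mate h, g.mate k} : Set g.H).ncard = 4 := by
    rw [Set.ncard_union_eq ?_ (Set.toFinite _) (Set.toFinite _), Set.ncard_pair hne,
      Set.ncard_pair (g.mate_injective.ne hne)]
    rw [Set.disjoint_left]
    intro x hx hx'
    have e1 : g.vert x = g.vert h := by
      rcases hx with rfl | rfl
      exacts [rfl, h1.symm]
    have e2 : g.vert x = g.vert (g.mate h) := by
      rcases hx' with rfl | rfl
      exacts [rfl, h2.symm]
    exact hab (e1.symm.trans e2)
  have hsub : ({h, k} ∪ {g.mate h, g.mate k} : Set g.H) ⊆ g.vert ⁻¹' W := by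
    rintro x ((rfl | rfl) | (rfl | rfl))
    exacts [Or.inl rfl, Or.inl h1.symm, Or.inr rfl, Or.inr h2.symm]
  have hcard := Set.ncard_sdiff_add_ncard_of_subset hsub
  rw [ncard_preimage_vert, hW, hD] at hcard
  have hk : g.mate k ≠ k := fun e => by
    rw [e, ← h1] at h2
    exact hab h2.symm
  have hout : {x | g.vert x ∈ W ∧ (g.mate x = x ∨ g.vert (g.mate x) ∉ W)} ⊆
      g.vert ⁻¹' W \ ({h, k} ∪ {g.mate h, g.mate k}) := by
    rintro x ⟨hx, hx'⟩
    refine ⟨hx, fun hD => ?_⟩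
    have hm : g.mate x ∈ ({h, k} ∪ {g.mate h, g.mate k} : Set g.H) := by
      rcases hD with (rfl | rfl) | (rfl | rfl) <;> simp [g.mate_mate]
    rcases hx' with hx' | hx'
    · rcases hD with (rfl | rfl) | (rfl | rfl)
      · exact hh hx'
      · exact hk hx'
      · exact hh (g.mate_injective hx')
      · exact hk (g.mate_injective hx')
    · exact hx' (hsub hm)
  have h3 := Set.ncard_le_ncard hout (Set.toFinite _)
  have h4 := hg.two_mul_ncard_lt_boundary_or_eq_zero hWu (by omega)
  omega

/-- Of the eight half-edges four are internal, and without self-loops each joins `a` to `b`; `mate`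
exchanges the two sides, leaving two on each. -/
theorem isFish_of_card_vertices_eq_two (hloop : ¬ g.HasSelfLoop) (hval : g.valence = 4)
    (hV : Nat.card g.V = 2) : g.IsFish := by
  obtain ⟨a, b, hab, huniv⟩ := Nat.card_eq_two_iff.1 hV
  have hall : ∀ v, v = a ∨ v = b := fun v => by
    have : v ∈ ({a, b} : Set g.V) := huniv ▸ Set.mem_univ v
    simpa using this
  refine ⟨hval, a, b, hab, hall, ?_⟩
  have h1 : Nat.card {h // g.vert h = a ∧ g.vert (g.mate h) = b} =
      Nat.card {h // g.vert h = b ∧ g.vert (g.mate h) = a} :=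
    Nat.card_congr ⟨fun h => ⟨g.mate h.1, h.2.2, by rw [g.mate_mate]; exact h.2.1⟩,
      fun h => ⟨g.mate h.1, h.2.2, by rw [g.mate_mate]; exact h.2.1⟩,
      fun h => Subtype.ext (g.mate_mate _), fun h => Subtype.ext (g.mate_mate _)⟩
  have h2 := card_subtype_add_card_subtype_not fun h : g.H => g.mate h = h
  change g.valence + _ = _ at h2
  rw [card_halfEdges, hval, hV] at h2
  have h3 := card_subtype_add_card_subtype_not
    fun h : {h : g.H // ¬ g.mate h = h} => g.vert h.1 = a
  have h4 : Nat.card {h : {h : g.H // ¬ g.mate h = h} // g.vert h.1 = a} =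
      Nat.card {h // g.vert h = a ∧ g.vert (g.mate h) = b} :=
    Nat.card_congr ⟨fun h => ⟨h.1.1, h.2, (hall _).resolve_left
        fun e => hloop ⟨_, h.1.2, e.trans h.2.symm⟩⟩,
      fun h => ⟨⟨h.1, fun e => hab (h.2.1.symm.trans ((congrArg g.vert e).symm.trans h.2.2))⟩, h.2.1⟩,
      fun _ => rfl, fun _ => rfl⟩
  have h5 : Nat.card {h : {h : g.H // ¬ g.mate h = h} // ¬ g.vert h.1 = a} =
      Nat.card {h // g.vert h = b ∧ g.vert (g.mate h) = a} :=
    Nat.card_congr ⟨fun h => ⟨h.1.1, (hall _).resolve_left h.2, (hall _).resolve_right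
        fun e => hloop ⟨_, h.1.2, e.trans ((hall _).resolve_left h.2).symm⟩⟩,
      fun h => ⟨⟨h.1, fun e => hab (h.2.2.symm.trans ((congrArg g.vert e).trans h.2.1))⟩,
        fun e => hab (e.symm.trans h.2.1)⟩,
      fun _ => rfl, fun _ => rfl⟩
  omega

/-- The vertex of a leg carries half of the legs, so there are at most two vertices. A circuit takes
four half-edges, and a leg with its partner is lost: `4c + 2 ≤ 4|V| ≤ 8`. -/
theorem IsPrimitive.numCircuits_le_of_valence_eq_two (h : g.IsPrimitive) (hval : g.valence = 2)
    (σ : g.Decomposition) : 3 * numCircuits σ + 1 ≤ 2 * Nat.card g.V := by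
  have : Nonempty {h : g.H // g.mate h = h} := by
    refine (Nat.card_pos_iff.1 ?_).1
    change 0 < g.valence
    omega
  obtain ⟨l, hl⟩ := this
  have h1 : 0 < {h | g.vert h = g.vert l ∧ g.mate h = h}.ncard :=
    (Set.ncard_pos (Set.toFinite _)).2 ⟨l, rfl, hl⟩
  have h2 : Nat.card g.V ≤ 2 := h.card_vertices_add_le (u := g.vert l) (by omega)
  have h3 := mul_numCircuits_add_ncard_le σ 4 {l, σ.1 l} (by
      rintro x (rfl | rfl)
      · exact ⟨_, (strand σ).refl' _, hl⟩
      · exact ⟨_, (strand σ).symm' (strand_pairing σ l), hl⟩)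
    (fun x hx => four_le_ncard_strand h.2.2.2.1 σ x (hx x ((strand σ).refl' x)))
  rw [Set.ncard_pair (σ.2.2.1 l).symm] at h3
  omega

theorem IsPrimitive.numCircuits_le_of_valence_eq_four (h : g.IsPrimitive) (hval : g.valence = 4)
    (hfish : ¬ g.IsFish) (σ : g.Decomposition) :
    3 * numCircuits σ + 4 ≤ 2 * Nat.card g.V := by
  -- One loop and four legs require at least two vertices, and exactly two would give the fish.
  have hV : 3 ≤ Nat.card g.V := by
    have h1 := g.two_mul_loopNumber
    have h2 := h.2.1
    have h3 : Nat.card g.V ≠ 2 :=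
      fun e => hfish (isFish_of_card_vertices_eq_two h.2.2.2.1 hval e)
    omega
  have hleg : ∀ l, g.mate l = l → g.mate (σ.1 l) ≠ σ.1 l := fun l hl e => by
    have h1 : 1 < {h | g.vert h = g.vert l ∧ g.mate h = h}.ncard :=
      (Set.one_lt_ncard (Set.toFinite _)).2
        ⟨l, ⟨rfl, hl⟩, σ.1 l, ⟨σ.2.2.2 l, e⟩, (σ.2.2.1 l).symm⟩
    have := h.card_vertices_add_le (u := g.vert l) (by omega)
    omega
  have hσ : Function.Injective σ.1 := (show Function.Involutive σ.1 from σ.2.1).injective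
  have h4 : {l | g.mate l = l}.ncard = 4 := hval
  -- No leg is paired with another leg, so the four legs and their partners are eight half-edges on
  -- open strands.
  have hT : ({l | g.mate l = l} ∪ σ.1 '' {l | g.mate l = l}).ncard = 8 := by
    rw [Set.ncard_union_eq ?_ (Set.toFinite _) (Set.toFinite _),
      Set.ncard_image_of_injective _ hσ, h4]
    rw [Set.disjoint_left]
    rintro _ hx ⟨l, hl, rfl⟩
    exact hleg l hl hx
  have h3 := mul_numCircuits_add_ncard_le σ 6 ({l | g.mate l = l} ∪ σ.1 '' {l | g.mate l = l}) (by
      rintro _ (hl | ⟨l, hl, rfl⟩)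
      · exact ⟨_, (strand σ).refl' _, hl⟩
      · exact ⟨_, (strand σ).symm' (strand_pairing σ l), hl⟩)
    (six_le_ncard_strand h.2.2.2.1 (h.not_double_edge hV) σ)
  omega

/-! ### Graphs of given coradical degree -/

theorem IsFishFreeOfCoradicalDegree.one_le {n : ℕ} (h : g.IsFishFreeOfCoradicalDegree n) :
    1 ≤ n := by
  unfold IsFishFreeOfCoradicalDegree at h
  induction h with
  | block => exact le_rfl
  | vertex => omega
  | edge => omega
  | iso => assumption

/-- Both parts of an insertion have degree at least one, so degree one involves no insertion, only a
block and isomorphisms. -/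
theorem IsFishFreeOfCoradicalDegree.isPrimitive (h : g.IsFishFreeOfCoradicalDegree 1) :
    g.IsPrimitive := by
  unfold IsFishFreeOfCoradicalDegree at h
  generalize hn : 1 = n at h
  induction h with
  | block g hg => exact hg.1
  | vertex g γ m n hg hγ =>
    have h1 := IsFishFreeOfCoradicalDegree.one_le hg
    have h2 := IsFishFreeOfCoradicalDegree.one_le hγ
    omega
  | edge g γ m n hg hγ =>
    have h1 := IsFishFreeOfCoradicalDegree.one_le hg
    have h2 := IsFishFreeOfCoradicalDegree.one_le hγ
    omega
  | iso g g' n hg i ih => exact i.isPrimitive (ih hn)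

/-- The vertex-type bound carries the offset `3` since replacing a vertex loses one vertex, which
costs `2`; the remaining `1` is slack. Inserting into an edge loses no vertex and needs no offset.
-/
theorem IsFishFreeOfCoradicalDegree.numCircuits_le {n : ℕ}
    (h : g.IsFishFreeOfCoradicalDegree n) :
    (g.valence = 2 ∧ ∀ σ : g.Decomposition, 3 * numCircuits σ + n ≤ 2 * Nat.card g.V) ∨
    (g.valence = 4 ∧ ∀ σ : g.Decomposition, 3 * numCircuits σ + n + 3 ≤ 2 * Nat.card g.V) := by
  unfold IsFishFreeOfCoradicalDegree at h
  induction h with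
  | block g hg =>
    exact hg.1.2.2.1.imp
      (fun hv => ⟨hv, hg.1.numCircuits_le_of_valence_eq_two hv⟩)
      (fun hv => ⟨hv, hg.1.numCircuits_le_of_valence_eq_four hv hg.2⟩)
  | vertex g γ m n hg hγ v φ ihg ihγ =>
    -- The matching `φ` forces the inserted graph to have as many legs as a vertex has half-edges.
    have hγ4 : γ.valence = 4 := (Nat.card_congr φ).symm.trans (g.four_valent v)
    have hγσ := (ihγ.resolve_left fun h => by omega).2
    have hV := card_vertices_insertVertex v φ
    rw [valence_insertVertex]
    refine ihg.imp (fun h => ⟨h.1, fun σ => ?_⟩) (fun h => ⟨h.1, fun σ => ?_⟩) <;>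
    · obtain ⟨σg, σγ, hσ⟩ := exists_numCircuits_insertVertex_le v φ σ
      have h1 := h.2 σg
      have h2 := hγσ σγ
      omega
  | edge g γ m n hg hγ e a b he ha hb hab hval ihg ihγ =>
    have hγσ := (ihγ.resolve_right fun h => by omega).2
    have hV := card_vertices_insertEdge e a b he ha hb hab
    rw [valence_insertEdge e a b he ha hb hab hval]
    refine ihg.imp (fun h => ⟨h.1, fun σ => ?_⟩) (fun h => ⟨h.1, fun σ => ?_⟩) <;>
    · obtain ⟨σg, σγ, hσ⟩ := exists_numCircuits_insertEdge_le e a b he ha hb hab hval σ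
      have h1 := h.2 σg
      have h2 := hγσ σγ
      omega
  | iso g g' n hg i ih =>
    rw [i.valence_eq, i.card_vertices_eq]
    refine ih.imp (fun h => ⟨h.1, fun σ => ?_⟩) (fun h => ⟨h.1, fun σ => ?_⟩) <;>
    · obtain ⟨σg, hσ⟩ := i.exists_numCircuits_le σ
      have h1 := h.2 σg
      omega

/-! ### From circuits to the degree of the symmetry factor -/

theorem nonempty_decomposition (g : FeynmanGraph) : Nonempty g.Decomposition := by
  obtain ⟨f, h1, h2, h3⟩ := exists_involution_of_even_classes (Setoid.ker g.vert) fun h => by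
    have e : Nat.card {k // Setoid.ker g.vert h k} = 4 := by
      rw [← g.four_valent (g.vert h)]
      exact Nat.card_congr (Equiv.subtypeEquivRight fun k => eq_comm)
    rw [e]
    decide
  exact ⟨⟨f, h1, h2, fun h => (h3 h).symm⟩⟩

/-- Dividing by `J(g, 1)` is multiplication by a constant, which cannot raise the degree. -/
theorem natDegree_symmetryFactor_le {d : ℕ} (h : ∀ σ : g.Decomposition, numCircuits σ ≤ d) :
    g.symmetryFactor.natDegree ≤ d := by
  refine (natDegree_C_mul_le _ _).trans (natDegree_sum_le_of_forall_le _ _ fun σ _ => ?_)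
  rw [natDegree_X_pow]
  exact h σ

end FeynmanGraph

theorem mainTheorem4 (g : FeynmanGraph) (L n : ℕ) (h1PI : g.IsOnePI) (hvertex : g.IsVertexType)
    (hL : g.loopNumber = (L : ℤ)) (hn : g.IsFishFreeOfCoradicalDegree n) :
    (g.symmetryFactor.natDegree : ℚ) ≤ 2 / 3 * (L : ℚ) - 1 / 3 * (n : ℚ) ∧
    (g.symmetryFactor.natDegree : ℚ) ≤ 2 / 3 * (L : ℚ) - 2 / 3 ∧
    ((g.symmetryFactor.natDegree : ℚ) = 2 / 3 * (L : ℚ) - 2 / 3 → g.IsPrimitive) := by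
  have hval : g.valence = 4 := hvertex
  have hσ := (hn.numCircuits_le.resolve_left fun h => by omega).2
  have hloop := g.two_mul_loopNumber
  rw [hL, hval] at hloop
  have hn1 := hn.one_le
  -- The existence of one decomposition gives `n + 3 ≤ 2|V|`, so the truncated subtraction in `hdeg`
  -- is a true one.
  have hσ0 := hσ g.nonempty_decomposition.some
  have hdeg : g.symmetryFactor.natDegree ≤ (2 * Nat.card g.V - n - 3) / 3 :=
    FeynmanGraph.natDegree_symmetryFactor_le fun σ => by
      have := hσ σ
      omega
  set d := g.symmetryFactor.natDegree
  have h1 : 3 * d + n ≤ 2 * L := by omega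
  have h2 : 3 * d + 2 ≤ 2 * L := by omega
  have h1' : 3 * (d : ℚ) + n ≤ 2 * L := by exact_mod_cast h1
  have h2' : 3 * (d : ℚ) + 2 ≤ 2 * L := by exact_mod_cast h2
  refine ⟨by linarith, by linarith, fun h => ?_⟩
  have h3 : 3 * d + 2 = 2 * L := by
    have : 3 * (d : ℚ) + 2 = 2 * L := by linarith
    exact_mod_cast this
  -- With `|V| = L + 1`, `hdeg` says `3d + n + 1 ≤ 2L`, one better than `h1`; together with `h3`
  -- this leaves `n ≤ 1`.
  obtain rfl : n = 1 := by omega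
  exact hn.isPrimitive
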